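/- Let $G$ be a finite non-stochastic two-player game: a finite directed graph $(V,E)$ in which every vertex has an out-edge, with $V$ partitioned into the vertices $V_1$ of Player 1 and $V_2$ of Player 2, and with a payoff $w(e)\in\mathbb{Q}$ on every edge $e \in E$. A play is an infinite path $v_0v_1v_2\cdots$ of the graph. For $\ell\ge 1$, the fixed window mean-payoff objective $\mathrm{FWMP}(\ell)$ is the set of plays for which there is $k\ge 0$ such that for every $i\ge k$ there is $j\in\{1,\dots,\ell\}$ with $\frac1j\sum_{m=i}^{i+j-1}w(v_m,v_{m+1})\ge 0$; the objective $\overline{\mathrm{FWMP}(\ell)}$ of Player 2 is the set of all other plays. Let $W\subseteq V$ be the winning region of Player 2, that is, the set of vertices $v$ from which Player 2 has a deterministic (history-dependent) strategy such that every play that starts in $v$ and is consistent with the strategy belongs to $\overline{\mathrm{FWMP}(\ell)}$. Proposition. The set $W$ is a trap for Player 1: every out-neighbour of a vertex in $W\cap V_1$ lies in $W$, and every vertex in $W\cap V_2$ has an out-neighbour in $W$. Moreover, Player 2 has a memoryless randomized strategy $\tau$ which, at every vertex $v\in W\cap V_2$, picks uniformly at random among the out-edges of $v$ that lead to $W$,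 and which is winning with probability $1$ from every vertex of $W$: for every $v\in W$ and every (history-dependent, possibly randomized) strategy $\sigma$ of Player 1, the random play that starts in $v$ and in which the players follow $\sigma$ and $\tau$ belongs to $\overline{\mathrm{FWMP}(\ell)}$ with probability $1$. -/

import Mathlib

open MeasureTheory ProbabilityTheory
open scoped ENNReal

/-- The two players. -/
inductive Player where
  | one : Player
  | two : Player

/-- A non-stochastic two-player game on the vertex set `V`: a directed graph without deadlocks,
a partition of the vertices into those of Player 1 and those of Player 2 (given by `owner`), and
rational payoffs on the edges (the value of `payoff` on pairs that are not edges is never used). -/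
structure NonStochasticGame (V : Type*) where
  Edge : V → V → Prop
  exists_edge : ∀ v, ∃ u, Edge v u
  owner : V → Player
  payoff : V → V → ℚ

namespace NonStochasticGame

variable {V : Type*}

/-- The set of out-neighbours of a vertex. -/
def out (G : NonStochasticGame V) (v : V) : Set V := {u | G.Edge v u}

/-- The set of all plays: the infinite paths of the graph. -/
def plays (G : NonStochasticGame V) : Set (ℕ → V) := {π | ∀ i, G.Edge (π i) (π (i + 1))}

/-- Histories `v₀ v₁ … vₙ` with `n` steps, as functions on `{0, …, n}`. -/
abbrev History (V : Type*) (n : ℕ) : Type _ := Finset.Iic n → V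

/-- The last vertex of a history. -/
def History.lastVertex {n : ℕ} (h : History V n) : V := h ⟨n, Finset.mem_Iic.2 le_rfl⟩

/-- The history formed by the first `n` steps of an infinite sequence of vertices. -/
def prefixOf (π : ℕ → V) (n : ℕ) : History V n := fun i => π i

/-- A (randomized, history-dependent) strategy of Player `p`. It assigns to every history that
ends in a vertex of Player `p` a probability distribution over the out-neighbours of that vertex.
It is written as a total function; its values at histories that end in a vertex of the opponent,
or that are not paths of the graph, play no role. -/
structure Strategy (G : NonStochasticGame V) (p : Player) where
  move : (n : ℕ) → History V n → PMF V
  legal : ∀ (n : ℕ) (h : History V n), G.owner h.lastVertex = p →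
    (move n h).support ⊆ G.out h.lastVertex

namespace Strategy

variable {G : NonStochasticGame V} {p : Player}

/-- The strategy always picks a single vertex with probability one. -/
def IsDeterministic (σ : Strategy G p) : Prop :=
  ∀ (n : ℕ) (h : History V n), G.owner h.lastVertex = p → ∃ u, (σ.move n h).support = {u}

/-- The chosen distribution depends only on the last vertex of the history. -/
def IsMemoryless (σ : Strategy G p) : Prop :=
  ∀ (n m : ℕ) (h : History V n) (h' : History V m), G.owner h.lastVertex = p →
    h.lastVertex = h'.lastVertex → σ.move n h = σ.move m h'

/-- A sequence of vertices is consistent with a strategy. For a deterministic strategy this says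
that every move of Player `p` is the vertex that the strategy picks. -/
def Consistent (σ : Strategy G p) (π : ℕ → V) : Prop :=
  ∀ j, G.owner (π j) = p → π (j + 1) ∈ (σ.move j (prefixOf π j)).support

end Strategy

/-- The winning region of Player `p` for the objective `Φ`: the initial vertices from which Player
`p` has a (deterministic) strategy all of whose consistent plays satisfy `Φ`. -/
def winningRegion (G : NonStochasticGame V) (p : Player) (Φ : Set (ℕ → V)) : Set V :=
  {v | ∃ σ : Strategy G p, σ.IsDeterministic ∧
    ∀ π ∈ G.plays, π 0 = v → σ.Consistent π → π ∈ Φ}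

/-- A trap for Player 1. -/
def IsTrapForOne (G : NonStochasticGame V) (T : Set V) : Prop :=
  ∀ v ∈ T, (G.owner v = Player.one → G.out v ⊆ T) ∧
    (G.owner v = Player.two → (G.out v ∩ T).Nonempty)

/-- The mean payoff of the infix `π(i, i + n)`, used for `n ≥ 1`. -/
def meanPayoff (G : NonStochasticGame V) (π : ℕ → V) (i n : ℕ) : ℚ :=
  (∑ k ∈ Finset.Ico i (i + n), G.payoff (π k) (π (k + 1))) / n

/-- The fixed window mean-payoff objective of window length `ℓ`. -/
def FWMP (G : NonStochasticGame V) (ℓ : ℕ) : Set (ℕ → V) :=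
  {π | π ∈ G.plays ∧ ∃ k, ∀ i ≥ k, ∃ j, 1 ≤ j ∧ j ≤ ℓ ∧ 0 ≤ G.meanPayoff π i j}

/-- The complementary objective, that of Player 2. -/
def coFWMP (G : NonStochasticGame V) (ℓ : ℕ) : Set (ℕ → V) := G.plays \ G.FWMP ℓ

/-- The distribution of the next vertex after a history, when the players use `σ` and `τ`. -/
noncomputable def nextVertex (G : NonStochasticGame V) (σ : Strategy G Player.one)
    (τ : Strategy G Player.two) (n : ℕ) (h : History V n) : PMF V :=
  match G.owner h.lastVertex with
  | Player.one => σ.move n h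
  | Player.two => τ.move n h

/-- `nextVertex` as a Markov kernel. -/
noncomputable def stepKernel [Finite V] [MeasurableSpace V] [DiscreteMeasurableSpace V]
    (G : NonStochasticGame V) (σ : Strategy G Player.one) (τ : Strategy G Player.two) (n : ℕ) :
    Kernel (History V n) V where
  toFun h := (G.nextVertex σ τ n h).toMeasure
  measurable' := measurable_of_countable _

instance [Finite V] [MeasurableSpace V] [DiscreteMeasurableSpace V]
    (G : NonStochasticGame V) (σ : Strategy G Player.one) (τ : Strategy G Player.two) (n : ℕ) :
    IsMarkovKernel (G.stepKernel σ τ n) :=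
  ⟨fun h => PMF.toMeasure.isProbabilityMeasure (G.nextVertex σ τ n h)⟩

/-- The law of the random outcome in `V^ω` for the profile `(σ, τ)` and the initial vertex `v`
(the Ionescu-Tulcea measure of the step kernels). -/
noncomputable def outcomeMeasure [Finite V] [MeasurableSpace V] [DiscreteMeasurableSpace V]
    (G : NonStochasticGame V) (σ : Strategy G Player.one) (τ : Strategy G Player.two) (v : V) :
    Measure (ℕ → V) :=
  Kernel.traj (X := fun _ => V) (G.stepKernel σ τ) 0 (fun _ => v)

/-- The strategy `τ` of Player 2 is winning for `Φ` from `v` with probability one, against every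
(randomized, history-dependent) strategy of Player 1. -/
def AlmostSurelyWinning [Finite V] [MeasurableSpace V] [DiscreteMeasurableSpace V]
    (G : NonStochasticGame V) (τ : Strategy G Player.two) (Φ : Set (ℕ → V)) (v : V) : Prop :=
  ∀ σ : Strategy G Player.one, G.outcomeMeasure σ τ v Φ = 1

/-- `p` is the uniform distribution on the finite nonempty set `S`. -/
def IsUniformOn (p : PMF V) (S : Set V) : Prop :=
  (∀ u ∈ S, p u = (S.ncard : ℝ≥0∞)⁻¹) ∧ ∀ u ∉ S, p u = 0

/-- In each turn taken at a vertex of `T`, the strategy picks uniformly at random among the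
out-edges that keep the token in `T`. -/
def Strategy.PlaysUniformlyIn {G : NonStochasticGame V} (τ : Strategy G Player.two) (T : Set V) :
    Prop :=
  ∀ (n : ℕ) (h : History V n), G.owner h.lastVertex = Player.two → h.lastVertex ∈ T →
    IsUniformOn (τ.move n h) (G.out h.lastVertex ∩ T)

end NonStochasticGame

/-! The objective of Player 2 ignores finite prefixes, so a winning strategy still wins after any
finite path consistent with it. Hence `W` is a trap, and plays that follow the strategy never leave
`W`.

From `v ∈ W`, consider the tree of paths consistent with a winning strategy. Every infinite branch
contains a window left open for `ℓ` steps, and branching is finite, so by König's argument Player 2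
can force such a window within a bounded number of steps inside `W` (`exists_canForce`). Let `N` be
a common bound over all `v`.

Under the uniform strategy each forcing move is chosen with probability at least `c = 1/|V|`. From
any history ending in `W`, an open window thus appears within the time of one attempt with
probability at least `c ^ N`. The token is still in `W` if the attempt fails, so attempts repeat:
the probability that all windows from `n` on close is at most `(1 - c ^ N) ^ r` for every `r`, hence
zero (`probAfter_closesFrom_eq_zero`). A countable union over `n` finishes the proof. -/

namespace NonStochasticGame

/-! ### Residual strategies and bounded forcing of an open window -/

section Deterministic

variable {V : Type*} {G : NonStochasticGame V} {ℓ : ℕ}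

/-- The window that opens at position `i` closes within `ℓ` steps. -/
def ClosesWindow (G : NonStochasticGame V) (ℓ : ℕ) (π : ℕ → V) (i : ℕ) : Prop :=
  ∃ j, 1 ≤ j ∧ j ≤ ℓ ∧ 0 ≤ G.meanPayoff π i j

lemma meanPayoff_congr {π ρ : ℕ → V} {i i' n : ℕ} (h : ∀ k ≤ n, π (i + k) = ρ (i' + k)) :
    G.meanPayoff π i n = G.meanPayoff ρ i' n := by
  unfold meanPayoff
  rw [Finset.sum_Ico_eq_sum_range, Finset.sum_Ico_eq_sum_range]
  simp only [Nat.add_sub_cancel_left]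
  congr 1
  refine Finset.sum_congr rfl fun k hk => ?_
  have hk := Finset.mem_range.1 hk
  rw [h k hk.le, add_assoc, h (k + 1) hk, add_assoc]

lemma closesWindow_congr {π ρ : ℕ → V} {i i' : ℕ} (h : ∀ k ≤ ℓ, π (i + k) = ρ (i' + k)) :
    G.ClosesWindow ℓ π i ↔ G.ClosesWindow ℓ ρ i' := by
  unfold ClosesWindow
  refine exists_congr fun j => and_congr_right fun _ => and_congr_right fun hj => ?_
  rw [meanPayoff_congr fun k hk => h k (hk.trans hj)]

lemma mem_coFWMP_iff {π : ℕ → V} :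
    π ∈ G.coFWMP ℓ ↔ π ∈ G.plays ∧ ∀ k, ∃ i ≥ k, ¬ G.ClosesWindow ℓ π i := by
  simp only [coFWMP, FWMP, Set.mem_sdiff, Set.mem_ofPred_eq, ClosesWindow]
  refine and_congr_right fun hp => ?_
  simp only [hp, true_and, not_exists, not_forall, exists_prop]

/-- The history that follows `π` up to time `t` and `h` from time `t` on. -/
def glueHistory (π : ℕ → V) (t n : ℕ) (h : History V n) : History V (t + n) := fun i =>
  if (i : ℕ) < t then π i else
    h ⟨i - t, Finset.mem_Iic.2 (by have := Finset.mem_Iic.1 i.2; omega)⟩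

lemma lastVertex_glueHistory (π : ℕ → V) (t n : ℕ) (h : History V n) :
    (glueHistory π t n h).lastVertex = h.lastVertex := by
  simp [glueHistory, History.lastVertex]

/-- The sequence that follows `π` up to time `t` and `ρ` from time `t` on. -/
def gluePlay (π : ℕ → V) (t : ℕ) (ρ : ℕ → V) : ℕ → V := fun i =>
  if i < t then π i else ρ (i - t)

lemma gluePlay_add (π : ℕ → V) (t : ℕ) (ρ : ℕ → V) (j : ℕ) : gluePlay π t ρ (t + j) = ρ j := by
  simp [gluePlay]

lemma gluePlay_of_le {π : ℕ → V} {t : ℕ} {ρ : ℕ → V} (h0 : ρ 0 = π t) {i : ℕ} (hi : i ≤ t) :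
    gluePlay π t ρ i = π i := by
  rcases hi.lt_or_eq with hi | rfl
  · simp [gluePlay, hi]
  · simpa [gluePlay] using h0

lemma prefixOf_congr {π ρ : ℕ → V} {t : ℕ} (h : ∀ i ≤ t, π i = ρ i) :
    prefixOf π t = prefixOf ρ t :=
  funext fun i => h i (Finset.mem_Iic.1 i.2)

lemma prefixOf_gluePlay (π : ℕ → V) (t : ℕ) (ρ : ℕ → V) (j : ℕ) :
    prefixOf (gluePlay π t ρ) (t + j) = glueHistory π t j (prefixOf ρ j) :=
  rfl

/-- The strategy that, after the initial segment of `π` up to time `t`, `s` prescribes. -/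
def Strategy.shift {p : Player} (s : Strategy G p) (π : ℕ → V) (t : ℕ) : Strategy G p where
  move n h := s.move (t + n) (glueHistory π t n h)
  legal n h hp := by
    have := s.legal (t + n) (glueHistory π t n h)
    rw [lastVertex_glueHistory] at this
    exact this hp

/-- The sequence `π` is, up to time `t`, a path that is consistent with `s`. -/
def Strategy.FollowsUpTo {p : Player} (s : Strategy G p) (t : ℕ) (π : ℕ → V) : Prop :=
  ∀ j < t, G.Edge (π j) (π (j + 1)) ∧
    (G.owner (π j) = p → π (j + 1) ∈ (s.move j (prefixOf π j)).support)

lemma Strategy.FollowsUpTo.congr {p : Player} {s : Strategy G p} {t : ℕ} {π ρ : ℕ → V}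
    (h : s.FollowsUpTo t π) (hπ : ∀ i ≤ t, π i = ρ i) : s.FollowsUpTo t ρ := by
  intro j hj
  rw [← hπ j hj.le, ← hπ (j + 1) hj, ← prefixOf_congr fun i hi => hπ i (hi.trans hj.le)]
  exact h j hj

/-- The strategy `s` of Player 2 wins all plays from `v`. -/
def Strategy.WinsFrom (s : Strategy G Player.two) (ℓ : ℕ) (v : V) : Prop :=
  s.IsDeterministic ∧ ∀ π ∈ G.plays, π 0 = v → s.Consistent π → π ∈ G.coFWMP ℓ

/-- The residual strategy wins: prepending the path to a play of the residual game gives a play of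
the original one, and only windows from `t` on matter for the objective. -/
lemma Strategy.WinsFrom.mem_winningRegion {s : Strategy G Player.two} {π : ℕ → V} {t : ℕ}
    (hs : s.WinsFrom ℓ (π 0)) (hπ : s.FollowsUpTo t π) :
    π t ∈ G.winningRegion Player.two (G.coFWMP ℓ) := by
  refine ⟨s.shift π t, fun n h hp => hs.1 _ _ (by rwa [lastVertex_glueHistory]), ?_⟩
  intro ρ hρ h0 hc
  have key : ∀ j, G.Edge (gluePlay π t ρ j) (gluePlay π t ρ (j + 1)) ∧
      (G.owner (gluePlay π t ρ j) = Player.two →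
        gluePlay π t ρ (j + 1) ∈ (s.move j (prefixOf (gluePlay π t ρ) j)).support) := by
    intro j
    rcases lt_or_ge j t with hj | hj
    · rw [gluePlay_of_le h0 hj.le, gluePlay_of_le h0 hj,
        prefixOf_congr fun i hi => gluePlay_of_le h0 (hi.trans hj.le)]
      exact hπ j hj
    · obtain ⟨i, rfl⟩ := Nat.exists_eq_add_of_le hj
      rw [gluePlay_add, add_assoc, gluePlay_add, prefixOf_gluePlay]
      exact ⟨hρ i, hc i⟩
  have hm := hs.2 (gluePlay π t ρ) (fun j => (key j).1) (gluePlay_of_le h0 (Nat.zero_le t))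
    (fun j => (key j).2)
  rw [mem_coFWMP_iff] at hm ⊢
  refine ⟨hρ, fun k => ?_⟩
  -- Asking for an open window after `t + k` places it in the part copied from `ρ`, at position at
  -- least `k` there.
  obtain ⟨i, hi, hw⟩ := hm.2 (t + k)
  obtain ⟨d, rfl⟩ := Nat.exists_eq_add_of_le ((Nat.le_add_right t k).trans hi)
  refine ⟨d, by omega, fun h => hw ((closesWindow_congr fun j _ => ?_).2 h)⟩
  rw [add_assoc, gluePlay_add]

lemma Strategy.FollowsUpTo.update {p : Player} {s : Strategy G p} {t : ℕ} {π : ℕ → V}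
    (h : s.FollowsUpTo t π) {u : V} (hu : G.Edge (π t) u)
    (hs : G.owner (π t) = p → u ∈ (s.move t (prefixOf π t)).support) :
    s.FollowsUpTo (t + 1) (Function.update π (t + 1) u) := by
  have hag : ∀ i ≤ t, π i = Function.update π (t + 1) u i := fun i hi => by
    rw [Function.update_of_ne (by omega)]
  intro j hj
  rcases (Nat.lt_succ_iff.1 hj).lt_or_eq with hj | rfl
  · exact h.congr hag j hj
  · rw [← prefixOf_congr hag, ← hag j le_rfl, Function.update_self]
    exact ⟨hu, hs⟩

lemma exists_mem_support_move {p : Player} (s : Strategy G p) {t : ℕ} {π : ℕ → V}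
    (hp : G.owner (π t) = p) :
    ∃ u, G.Edge (π t) u ∧ u ∈ (s.move t (prefixOf π t)).support := by
  obtain ⟨u, hu⟩ := (s.move t (prefixOf π t)).support_nonempty
  exact ⟨u, s.legal t (prefixOf π t) hp hu, hu⟩

theorem isTrapForOne_winningRegion :
    G.IsTrapForOne (G.winningRegion Player.two (G.coFWMP ℓ)) := by
  rintro v ⟨s, hs⟩
  have hs' : s.WinsFrom ℓ v := hs
  have step : ∀ u, G.Edge v u →
      (G.owner v = Player.two → u ∈ (s.move 0 (prefixOf (fun _ => v) 0)).support) →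
      u ∈ G.winningRegion Player.two (G.coFWMP ℓ) := by
    intro u hu hc
    have h0 : s.FollowsUpTo 0 (fun _ => v) := fun j hj => absurd hj (Nat.not_lt_zero j)
    simpa using Strategy.WinsFrom.mem_winningRegion (π := Function.update (fun _ => v) 1 u)
      (by simpa using hs') (h0.update hu hc)
  constructor
  · exact fun h1 u hu => step u hu fun h2 => by simp [h1] at h2
  · intro h2
    obtain ⟨u, hu, hm⟩ := exists_mem_support_move s (t := 0) (π := fun _ => v) h2
    exact ⟨u, hu, step u hu fun _ => hm⟩

/-- Player 2 can force within `k` further steps, while staying in `T`, that after the initial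
segment of `π` up to time `t` some window has not closed within `ℓ` steps. -/
def CanForce (G : NonStochasticGame V) (ℓ : ℕ) (T : Set V) : ℕ → ℕ → (ℕ → V) → Prop
  | 0, t, π => ∃ i, i + ℓ ≤ t ∧ ¬ G.ClosesWindow ℓ π i
  | k + 1, t, π => CanForce G ℓ T k t π ∨
      (G.owner (π t) = Player.one ∧
        ∀ u ∈ G.out (π t), CanForce G ℓ T k (t + 1) (Function.update π (t + 1) u)) ∨
      (G.owner (π t) = Player.two ∧
        ∃ u ∈ G.out (π t) ∩ T, CanForce G ℓ T k (t + 1) (Function.update π (t + 1) u))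

variable {T : Set V}

lemma CanForce.congr {k : ℕ} : ∀ {t : ℕ} {π ρ : ℕ → V}, G.CanForce ℓ T k t π →
    (∀ i ≤ t, π i = ρ i) → G.CanForce ℓ T k t ρ := by
  induction k with
  | zero =>
    rintro t π ρ ⟨i, hi, hw⟩ h
    exact ⟨i, hi, fun hc => hw ((closesWindow_congr fun j hj => h _ (by omega)).2 hc)⟩
  | succ k ih =>
    intro t π ρ hf h
    have hup : ∀ u, ∀ i ≤ t + 1, Function.update π (t + 1) u i = Function.update ρ (t + 1) u i := by
      intro u i hi
      rcases hi.lt_or_eq with hi | rfl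
      · rw [Function.update_of_ne hi.ne, Function.update_of_ne hi.ne, h i (Nat.lt_succ_iff.1 hi)]
      · simp
    unfold CanForce at hf ⊢
    rw [← h t le_rfl]
    rcases hf with hf | ⟨h1, hf⟩ | ⟨h2, u, hu, hf⟩
    · exact Or.inl (ih hf h)
    · exact Or.inr (Or.inl ⟨h1, fun u hu => ih (hf u hu) (hup u)⟩)
    · exact Or.inr (Or.inr ⟨h2, u, hu, ih hf (hup u)⟩)

lemma CanForce.mono {k l t : ℕ} {π : ℕ → V} (hkl : k ≤ l) (h : G.CanForce ℓ T k t π) :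
    G.CanForce ℓ T l t π := by
  induction l, hkl using Nat.le_induction with
  | base => exact h
  | succ l _ ih => exact Or.inl ih

/-- A property of finite paths that can always be preserved in one more step holds for all
prefixes of some infinite sequence. -/
lemma exists_forall_of_extend {P : ℕ → (ℕ → V) → Prop}
    (hcongr : ∀ t π ρ, (∀ i ≤ t, π i = ρ i) → P t π → P t ρ) {π₀ : ℕ → V} (h0 : P 0 π₀)
    (hstep : ∀ t π, P t π → ∃ u, P (t + 1) (Function.update π (t + 1) u)) :
    ∃ π : ℕ → V, π 0 = π₀ 0 ∧ ∀ t, P t π := by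
  have : Nonempty V := ⟨π₀ 0⟩
  choose! f hf using hstep
  let ρ : ℕ → ℕ → V := fun t => Nat.rec π₀ (fun t π => Function.update π (t + 1) (f t π)) t
  have hρs : ∀ t, ρ (t + 1) = Function.update (ρ t) (t + 1) (f t (ρ t)) := fun t => rfl
  have hρ : ∀ t, P t (ρ t) := by
    intro t
    induction t with
    | zero => exact h0
    | succ t ih => rw [hρs]; exact hf t _ ih
  have hstab : ∀ i t, i ≤ t → ρ t i = ρ i i := by
    intro i t hit
    induction t, hit using Nat.le_induction with
    | base => rfl
    | succ t hit ih => rw [hρs, Function.update_of_ne (by omega), ih]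
  exact ⟨fun i => ρ i i, rfl, fun t => hcongr t _ _ (fun i hi => hstab i t hi) (hρ t)⟩

/-- König's argument: if no number of steps suffices, some consistent successor has the same defect.
Iterating yields an infinite consistent play without open windows, which contradicts that the
strategy wins. -/
theorem exists_canForce [Finite V] {v : V}
    (hv : v ∈ G.winningRegion Player.two (G.coFWMP ℓ)) :
    ∃ k, G.CanForce ℓ (G.winningRegion Player.two (G.coFWMP ℓ)) k 0 (fun _ => v) := by
  have := Fintype.ofFinite V
  obtain ⟨s, hs⟩ := hv
  have hs : s.WinsFrom ℓ v := hs
  set T := G.winningRegion Player.two (G.coFWMP ℓ) with hT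
  by_contra! hno
  obtain ⟨π, hπ0, hπ⟩ := exists_forall_of_extend (π₀ := fun _ => v)
    (P := fun t π => π 0 = v ∧ s.FollowsUpTo t π ∧ ∀ k, ¬ G.CanForce ℓ T k t π)
    (fun t π ρ h hP => ⟨h 0 (Nat.zero_le t) ▸ hP.1, hP.2.1.congr h, fun k hk =>
      hP.2.2 k (hk.congr fun i hi => (h i hi).symm)⟩)
    ⟨rfl, fun j hj => absurd hj (Nat.not_lt_zero j), hno⟩ (by
      rintro t π ⟨h0, hf, hk⟩
      have h0' : ∀ u, Function.update π (t + 1) u 0 = v := fun u => by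
        rw [Function.update_of_ne (by omega), h0]
      cases ho : G.owner (π t) with
      | one =>
        -- If each successor had its own bound, the maximum of these finitely many bounds, plus one,
        -- would work at `π t`.
        by_contra! hu
        have hex : ∀ u, ∃ k, u ∈ G.out (π t) →
            G.CanForce ℓ T k (t + 1) (Function.update π (t + 1) u) := by
          intro u
          by_cases he : u ∈ G.out (π t)
          · obtain ⟨k, hk⟩ := hu u (h0' u) (hf.update he fun h2 => by simp [ho] at h2)
            exact ⟨k, fun _ => hk⟩
          · exact ⟨0, fun h => absurd h he⟩
        choose K hK using hex
        exact hk (Finset.univ.sup K + 1) (Or.inr (Or.inl ⟨ho, fun u hu =>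
          (hK u hu).mono (Finset.le_sup (Finset.mem_univ u))⟩))
      | two =>
        obtain ⟨u, hu, hm⟩ := exists_mem_support_move s ho
        have hf' := hf.update hu fun _ => hm
        refine ⟨u, h0' u, hf', fun k hc => hk (k + 1) (Or.inr (Or.inr ⟨ho, u, ⟨hu, ?_⟩, hc⟩))⟩
        simpa using Strategy.WinsFrom.mem_winningRegion (by rwa [h0' u]) hf')
  have hm := hs.2 π (fun j => ((hπ (j + 1)).2.1 j j.lt_succ_self).1) hπ0
    (fun j => ((hπ (j + 1)).2.1 j j.lt_succ_self).2)
  -- A window opened at `i` is decided by the path up to time `i + ℓ`, where zero further steps are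
  -- needed.
  obtain ⟨i, -, hi⟩ := (mem_coFWMP_iff.1 hm).2 0
  exact (hπ (i + ℓ)).2.2 0 ⟨i, le_rfl, hi⟩

end Deterministic

/-! ### The law of the play, one step at a time -/

section Outcome

variable {V : Type*} {G : NonStochasticGame V} {σ : Strategy G Player.one}
  {τ : Strategy G Player.two}

lemma edge_of_nextVertex_ne_zero {t : ℕ} {π : ℕ → V} {u : V}
    (hu : G.nextVertex σ τ t (prefixOf π t) u ≠ 0) : G.Edge (π t) u := by
  unfold nextVertex at hu
  split at hu
  · next h => exact σ.legal t _ h ((PMF.mem_support_iff _ _).2 hu)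
  · next h => exact τ.legal t _ h ((PMF.mem_support_iff _ _).2 hu)

lemma sum_nextVertex [Fintype V] (t : ℕ) (h : History V t) :
    ∑ u, (G.nextVertex σ τ t h u).toReal = 1 := by
  rw [← ENNReal.toReal_sum fun u _ => PMF.apply_ne_top _ u, ← tsum_fintype (L := .unconditional _),
    PMF.tsum_coe, ENNReal.toReal_one]

variable [Finite V] [MeasurableSpace V] [DiscreteMeasurableSpace V]

/-- The probability of `A` after the initial segment of `π` up to time `t`. -/
noncomputable def probAfter (G : NonStochasticGame V) (σ : Strategy G Player.one)
    (τ : Strategy G Player.two) (A : Set (ℕ → V)) (t : ℕ) (π : ℕ → V) : ℝ :=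
  (Kernel.traj (X := fun _ => V) (G.stepKernel σ τ) t (prefixOf π t)).real A

/-- Markov decomposition: the trajectory kernel from time `t` is one step followed by the trajectory
kernel from time `t + 1`. -/
lemma traj_apply_eq_lintegral (t : ℕ) (π : ℕ → V) {A : Set (ℕ → V)} (hA : MeasurableSet A) :
    Kernel.traj (X := fun _ => V) (G.stepKernel σ τ) t (prefixOf π t) A =
      ∫⁻ u, Kernel.traj (X := fun _ => V) (G.stepKernel σ τ) (t + 1)
        (prefixOf (Function.update π (t + 1) u) (t + 1)) A
          ∂(G.nextVertex σ τ t (prefixOf π t)).toMeasure := by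
  have hm : Measurable fun x : (i : Finset.Iic (t + 1)) → V =>
      Kernel.traj (X := fun _ => V) (G.stepKernel σ τ) (t + 1) x A := Kernel.measurable_coe _ hA
  conv_lhs => rw [← Kernel.traj_comp_partialTraj (X := fun _ => V)
    (κ := G.stepKernel σ τ) (Nat.le_succ t)]
  rw [Kernel.comp_apply' _ _ _ hA, Kernel.partialTraj_succ_self,
    Kernel.map_apply _ (by fun_prop), lintegral_map hm (by fun_prop),
    Kernel.lintegral_id_prod (by fun_prop), Kernel.map_apply _ (by fun_prop),
    lintegral_map (by fun_prop) (by fun_prop)]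
  refine lintegral_congr fun u => ?_
  congr 2
  funext i
  by_cases hi : (i : ℕ) ≤ t
  · simp [IicProdIoc, hi, prefixOf, Function.update_of_ne (show (i : ℕ) ≠ t + 1 by omega)]
  · obtain ⟨i, hi'⟩ := i
    obtain rfl : i = t + 1 := by have := Finset.mem_Iic.1 hi'; simp at hi; omega
    simp [IicProdIoc, prefixOf, MeasurableEquiv.piSingleton]

lemma probAfter_eq_sum [Fintype V] (t : ℕ) (π : ℕ → V) {A : Set (ℕ → V)}
    (hA : MeasurableSet A) :
    G.probAfter σ τ A t π = ∑ u, (G.nextVertex σ τ t (prefixOf π t) u).toReal *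
      G.probAfter σ τ A (t + 1) (Function.update π (t + 1) u) := by
  unfold probAfter
  rw [measureReal_def, traj_apply_eq_lintegral t π hA, lintegral_fintype, ENNReal.toReal_sum]
  · refine Finset.sum_congr rfl fun u _ => ?_
    rw [PMF.toMeasure_apply_singleton _ _ (measurableSet_singleton u), ENNReal.toReal_mul,
      mul_comm, measureReal_def]
  · exact fun u _ => ENNReal.mul_ne_top (measure_ne_top _ _) (measure_ne_top _ _)

lemma probAfter_nonneg (A : Set (ℕ → V)) (t : ℕ) (π : ℕ → V) : 0 ≤ G.probAfter σ τ A t π :=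
  measureReal_nonneg

lemma probAfter_le_one (A : Set (ℕ → V)) (t : ℕ) (π : ℕ → V) : G.probAfter σ τ A t π ≤ 1 :=
  measureReal_le_one

lemma probAfter_eq_zero_of_disjoint {t : ℕ} {π : ℕ → V} {A : Set (ℕ → V)}
    (h : ∀ ρ ∈ A, ¬ ∀ i ≤ t, ρ i = π i) : G.probAfter σ τ A t π = 0 := by
  -- Given the history up to `t`, the law of the first `t` steps is a point mass.
  have hd : (Kernel.traj (X := fun _ => V) (G.stepKernel σ τ) t (prefixOf π t)).map
      (Preorder.frestrictLe t) = Measure.dirac (prefixOf π t) := by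
    rw [Kernel.traj_map_frestrictLe_apply, Kernel.partialTraj_self, Kernel.id_apply]
  have hs : MeasurableSet {x : (i : Finset.Iic t) → V | x ≠ prefixOf π t} := by measurability
  have h0 : Kernel.traj (X := fun _ => V) (G.stepKernel σ τ) t (prefixOf π t)
      (Preorder.frestrictLe t ⁻¹' {x : (i : Finset.Iic t) → V | x ≠ prefixOf π t}) = 0 := by
    rw [← Measure.map_apply (Preorder.measurable_frestrictLe t) hs, hd, Measure.dirac_apply' _ hs]
    simp
  rw [probAfter, measureReal_def, measure_mono_null (fun ρ hρ he => ?_) h0, ENNReal.toReal_zero]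
  exact h ρ hρ fun i hi => congrFun he ⟨i, Finset.mem_Iic.2 hi⟩

lemma measurableSet_setOf_edge (G : NonStochasticGame V) (i : ℕ) :
    MeasurableSet {π : ℕ → V | G.Edge (π i) (π (i + 1))} :=
  (show Measurable fun π : ℕ → V => (π i, π (i + 1)) by fun_prop)
    (MeasurableSet.of_discrete (s := {p : V × V | G.Edge p.1 p.2}))

lemma measurable_meanPayoff (G : NonStochasticGame V) (i n : ℕ) :
    Measurable fun π : ℕ → V => G.meanPayoff π i n := by
  unfold meanPayoff
  refine Measurable.div_const (Finset.measurable_sum _ fun k _ => ?_) _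
  exact (measurable_of_countable fun p : V × V => G.payoff p.1 p.2).comp
    (show Measurable fun π : ℕ → V => (π k, π (k + 1)) by fun_prop)

/-- At time `i` legality of the strategies excludes non-edges; averaging carries the value zero back
to earlier times. -/
lemma probAfter_not_edge_eq_zero (i : ℕ) : ∀ {t : ℕ}, t ≤ i → ∀ π : ℕ → V,
    G.probAfter σ τ {ρ | ¬ G.Edge (ρ i) (ρ (i + 1))} t π = 0 := by
  have := Fintype.ofFinite V
  have hA := (measurableSet_setOf_edge G i).compl
  intro t ht
  induction ht using Nat.decreasingInduction with
  | self =>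
    intro π
    refine (probAfter_eq_sum i π hA).trans (Finset.sum_eq_zero fun u _ => ?_)
    by_cases hu : G.nextVertex σ τ i (prefixOf π i) u = 0
    · simp [hu]
    · refine mul_eq_zero_of_right _ (probAfter_eq_zero_of_disjoint fun ρ hρ he => hρ ?_)
      have h1 := he i (Nat.le_succ i)
      have h2 := he (i + 1) le_rfl
      rw [Function.update_of_ne (Nat.succ_ne_self i).symm] at h1
      rw [Function.update_self] at h2
      change G.Edge (ρ i) (ρ (i + 1))
      rw [h1, h2]
      exact edge_of_nextVertex_ne_zero hu
  | of_succ t _ ih =>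
    intro π
    refine (probAfter_eq_sum t π hA).trans (Finset.sum_eq_zero fun u _ => ?_)
    exact mul_eq_zero_of_right _ (ih _)

end Outcome

/-! ### Repeated attempts at forcing an open window -/

section Repetition

variable {V : Type*} {G : NonStochasticGame V} {ℓ : ℕ} {T : Set V}
  {σ : Strategy G Player.one} {τ : Strategy G Player.two}

lemma nextVertex_of_owner_two {t : ℕ} {h : History V t} (ho : G.owner h.lastVertex = Player.two) :
    G.nextVertex σ τ t h = τ.move t h := by
  unfold nextVertex
  split
  · next h' => simp [ho] at h'
  · rfl

/-- The plays all of whose windows from position `n` on close within `ℓ` steps. -/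
def closesFrom (G : NonStochasticGame V) (ℓ n : ℕ) : Set (ℕ → V) :=
  {π | ∀ i ≥ n, G.ClosesWindow ℓ π i}

/-- In vertices of `T`, Player 2 stays in `T` and moves to each neighbour in `T` with
probability at least `c`. -/
def Strategy.MixesIn (τ : Strategy G Player.two) (T : Set V) (c : ℝ) : Prop :=
  ∀ (n : ℕ) (h : History V n), G.owner h.lastVertex = Player.two → h.lastVertex ∈ T →
    (∀ u ∈ G.out h.lastVertex ∩ T, c ≤ (τ.move n h u).toReal) ∧
      ∀ u, τ.move n h u ≠ 0 → u ∈ T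

lemma mem_of_nextVertex_ne_zero {c : ℝ} (hT : G.IsTrapForOne T) (hτ : τ.MixesIn T c) {t : ℕ}
    {π : ℕ → V} (hπ : π t ∈ T) {u : V} (hu : G.nextVertex σ τ t (prefixOf π t) u ≠ 0) : u ∈ T := by
  cases ho : G.owner (π t) with
  | one => exact (hT _ hπ).1 ho (edge_of_nextVertex_ne_zero hu)
  | two =>
    rw [nextVertex_of_owner_two ho] at hu
    exact (hτ t (prefixOf π t) ho hπ).2 u hu

variable [Finite V] [MeasurableSpace V] [DiscreteMeasurableSpace V]

lemma measurableSet_closesFrom (n : ℕ) : MeasurableSet (G.closesFrom ℓ n) := by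
  have : G.closesFrom ℓ n = ⋂ i ∈ Set.Ici n, ⋃ j ∈ Set.Icc 1 ℓ, {π | 0 ≤ G.meanPayoff π i j} := by
    ext π
    simp only [closesFrom, ClosesWindow, Set.mem_ofPred_eq, Set.mem_iInter, Set.mem_iUnion,
      Set.mem_Ici, Set.mem_Icc, exists_prop, and_assoc, ge_iff_le]
  rw [this]
  exact .biInter (Set.to_countable _) fun i _ => .biUnion (Set.to_countable _) fun j _ =>
    measurableSet_le measurable_const (measurable_meanPayoff G i j)

lemma probAfter_le_of_forall_le {A : Set (ℕ → V)} (hA : MeasurableSet A) {t : ℕ} {π : ℕ → V}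
    {b : ℝ} (h : ∀ u, G.nextVertex σ τ t (prefixOf π t) u ≠ 0 →
      G.probAfter σ τ A (t + 1) (Function.update π (t + 1) u) ≤ b) :
    G.probAfter σ τ A t π ≤ b := by
  have := Fintype.ofFinite V
  rw [probAfter_eq_sum t π hA]
  calc _ ≤ ∑ u, (G.nextVertex σ τ t (prefixOf π t) u).toReal * b := by
        refine Finset.sum_le_sum fun u _ => ?_
        by_cases hu : G.nextVertex σ τ t (prefixOf π t) u = 0
        · simp [hu]
        · exact mul_le_mul_of_nonneg_left (h u hu) ENNReal.toReal_nonneg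
    _ = b := by rw [← Finset.sum_mul, sum_nextVertex, one_mul]

lemma probAfter_le_of_exists_le {A : Set (ℕ → V)} (hA : MeasurableSet A) {t : ℕ} {π : ℕ → V}
    {c d q : ℝ} (hd : 0 ≤ d) (h : ∀ u, G.nextVertex σ τ t (prefixOf π t) u ≠ 0 →
      G.probAfter σ τ A (t + 1) (Function.update π (t + 1) u) ≤ q) {u : V}
    (hc : c ≤ (G.nextVertex σ τ t (prefixOf π t) u).toReal)
    (hu : G.probAfter σ τ A (t + 1) (Function.update π (t + 1) u) ≤ q - d) :
    G.probAfter σ τ A t π ≤ q - c * d := by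
  classical
  have := Fintype.ofFinite V
  rw [probAfter_eq_sum t π hA]
  calc _ ≤ ∑ w, (G.nextVertex σ τ t (prefixOf π t) w).toReal * (q - if w = u then d else 0) := by
        refine Finset.sum_le_sum fun w _ => ?_
        by_cases hw : G.nextVertex σ τ t (prefixOf π t) w = 0
        · simp [hw]
        · refine mul_le_mul_of_nonneg_left ?_ ENNReal.toReal_nonneg
          split_ifs with he
          · rwa [he]
          · simpa using h w hw
    _ = q - (G.nextVertex σ τ t (prefixOf π t) u).toReal * d := by
        simp [mul_sub, Finset.sum_sub_distrib, ← Finset.sum_mul, sum_nextVertex]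
    _ ≤ q - c * d := by gcongr

/-- One attempt improves a uniform bound `q` to `(1 - c ^ k) * q`: with probability at least `c ^ k`
the forcing moves are followed and the event fails, and otherwise the token is still in `T`, where
`q` applies. Forcing refers to the path restarted at `m ≥ n`, so that the window it leaves open is
one that `closesFrom` counts. -/
lemma probAfter_closesFrom_le_of_canForce {c q : ℝ} {n m : ℕ} (hT : G.IsTrapForOne T)
    (hτ : τ.MixesIn T c) (hc : 0 ≤ c) (hc1 : c ≤ 1) (hq : 0 ≤ q) (hnm : n ≤ m)
    (hle : ∀ t ≥ n, ∀ π : ℕ → V, π t ∈ T → G.probAfter σ τ (G.closesFrom ℓ n) t π ≤ q) (k : ℕ) :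
    ∀ (t : ℕ) (π : ℕ → V), π (m + t) ∈ T → G.CanForce ℓ T k t (fun i => π (m + i)) →
      G.probAfter σ τ (G.closesFrom ℓ n) (m + t) π ≤ q - c ^ k * q := by
  have hA := measurableSet_closesFrom (G := G) (ℓ := ℓ) n
  have hshift : ∀ (t : ℕ) (π : ℕ → V) (u : V), (fun i => Function.update π (m + t + 1) u (m + i)) =
      Function.update (fun i => π (m + i)) (t + 1) u := by
    intro t π u
    funext i
    by_cases hi : i = t + 1
    · subst hi; simp [add_assoc]
    · rw [Function.update_of_ne hi, Function.update_of_ne (by omega)]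
  induction k with
  | zero =>
    rintro t π - ⟨i, hi, hw⟩
    rw [probAfter_eq_zero_of_disjoint fun ρ hρ he => hw ?_]
    · simp
    · refine (closesWindow_congr fun j hj => ?_).1 (hρ (m + i) (by omega))
      rw [he _ (by omega), add_assoc]
  | succ k ih =>
    intro t π hπ hf
    have hpow : q - c ^ k * q ≤ q - c ^ (k + 1) * q := by
      have : c ^ (k + 1) ≤ c ^ k := pow_le_pow_of_le_one hc hc1 (Nat.le_succ k)
      gcongr
    rcases hf with hf | ⟨h1, hf⟩ | ⟨h2, u, hu, hf⟩
    · exact (ih t π hπ hf).trans hpow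
    · refine (probAfter_le_of_forall_le hA fun u hu => ?_).trans hpow
      refine ih (t + 1) _ ?_ ?_
      · rw [← add_assoc, Function.update_self]
        exact mem_of_nextVertex_ne_zero hT hτ hπ hu
      · rw [hshift]
        exact hf u (edge_of_nextVertex_ne_zero hu)
    -- The forcing move `u` has probability at least `c` and gains `c ^ k * q` by induction; every
    -- other move stays in `T` and keeps the bound `q`.
    · rw [pow_succ', mul_assoc]
      refine probAfter_le_of_exists_le hA (by positivity) (fun w hw => ?_)
        (u := u) ?_ (ih (t + 1) _ ?_ ?_)
      · refine hle _ (by omega) _ ?_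
        rw [Function.update_self]
        exact mem_of_nextVertex_ne_zero hT hτ hπ hw
      · rw [nextVertex_of_owner_two h2]
        exact (hτ _ (prefixOf π (m + t)) h2 hπ).1 u hu
      · rw [← add_assoc, Function.update_self]
        exact hu.2
      · rw [hshift]
        exact hf

lemma probAfter_closesFrom_eq_zero {c : ℝ} {n N : ℕ} (hT : G.IsTrapForOne T)
    (hτ : τ.MixesIn T c) (hc : 0 < c) (hc1 : c ≤ 1)
    (hN : ∀ v ∈ T, G.CanForce ℓ T N 0 (fun _ => v)) :
    ∀ t ≥ n, ∀ π : ℕ → V, π t ∈ T → G.probAfter σ τ (G.closesFrom ℓ n) t π = 0 := by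
  have hr0 : 0 ≤ 1 - c ^ N := sub_nonneg.2 (pow_le_one₀ hc.le hc1)
  have hr1 : 1 - c ^ N < 1 := sub_lt_self _ (pow_pos hc N)
  have hle : ∀ r, ∀ t ≥ n, ∀ π : ℕ → V, π t ∈ T →
      G.probAfter σ τ (G.closesFrom ℓ n) t π ≤ (1 - c ^ N) ^ r := by
    intro r
    induction r with
    | zero => intro t _ π _; simpa using probAfter_le_one _ _ _
    | succ r ih =>
      intro t ht π hπ
      have := probAfter_closesFrom_le_of_canForce hT hτ hc.le hc1 (pow_nonneg hr0 r) ht ih N 0 π hπ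
        ((hN _ hπ).congr fun i hi => by rw [Nat.le_zero.1 hi, add_zero])
      rw [add_zero] at this
      exact this.trans_eq (by ring)
  intro t ht π hπ
  exact le_antisymm (ge_of_tendsto' (tendsto_pow_atTop_nhds_zero_of_lt_one hr0 hr1)
    fun r => hle r t ht π hπ) (probAfter_nonneg _ _ _)

/-- Before time `n` an open window need not violate the event, so the attempts start at `n`;
averaging over the moves up to then carries zero back. -/
lemma probAfter_closesFrom_eq_zero_of_le {c : ℝ} {n N : ℕ} (hT : G.IsTrapForOne T)
    (hτ : τ.MixesIn T c) (hc : 0 < c) (hc1 : c ≤ 1)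
    (hN : ∀ v ∈ T, G.CanForce ℓ T N 0 (fun _ => v)) {t : ℕ} (ht : t ≤ n) :
    ∀ π : ℕ → V, π t ∈ T → G.probAfter σ τ (G.closesFrom ℓ n) t π = 0 := by
  induction ht using Nat.decreasingInduction with
  | self => exact probAfter_closesFrom_eq_zero hT hτ hc hc1 hN n le_rfl
  | of_succ t _ ih =>
    intro π hπ
    refine le_antisymm (probAfter_le_of_forall_le (measurableSet_closesFrom n) fun u hu => ?_)
      (probAfter_nonneg _ _ _)
    refine (ih _ ?_).le
    rw [Function.update_self]
    exact mem_of_nextVertex_ne_zero hT hτ hπ hu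

theorem almostSurelyWinning_of_canForce {c : ℝ} {N : ℕ} (hT : G.IsTrapForOne T)
    (hτ : τ.MixesIn T c) (hc : 0 < c) (hc1 : c ≤ 1)
    (hN : ∀ v ∈ T, G.CanForce ℓ T N 0 (fun _ => v)) {v : V} (hv : v ∈ T) :
    G.AlmostSurelyWinning τ (G.coFWMP ℓ) v := by
  intro σ
  have hμ : IsProbabilityMeasure (G.outcomeMeasure σ τ v) := by
    unfold outcomeMeasure
    infer_instance
  have hnull : ∀ A : Set (ℕ → V), G.probAfter σ τ A 0 (fun _ => v) = 0 →
      G.outcomeMeasure σ τ v A = 0 :=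
    fun A hA => (measureReal_eq_zero_iff (measure_ne_top (G.outcomeMeasure σ τ v) A)).1 hA
  rw [measure_of_measure_compl_eq_zero, measure_univ]
  refine measure_mono_null (t := (⋃ i, {ρ : ℕ → V | ¬ G.Edge (ρ i) (ρ (i + 1))}) ∪
    ⋃ n, G.closesFrom ℓ n) (fun π hπ => ?_) (measure_union_null
      (measure_iUnion_null fun i => hnull _ (probAfter_not_edge_eq_zero i (Nat.zero_le i) _))
      (measure_iUnion_null fun n => hnull _
        (probAfter_closesFrom_eq_zero_of_le hT hτ hc hc1 hN (Nat.zero_le n) _ hv)))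
  rw [Set.mem_compl_iff, mem_coFWMP_iff, not_and_or] at hπ
  simpa [plays, closesFrom] using hπ

end Repetition

/-! ### The uniform strategy on a trap -/

section UniformStrategy

variable {V : Type*} [Finite V] {G : NonStochasticGame V} {T : Set V}

open Classical in
/-- The set of out-neighbours in `T`, or of all out-neighbours where there is none in `T`. -/
noncomputable def choices (G : NonStochasticGame V) (T : Set V) (v : V) : Finset V :=
  (Set.toFinite (if (G.out v ∩ T).Nonempty then G.out v ∩ T else G.out v)).toFinset

lemma choices_nonempty (G : NonStochasticGame V) (T : Set V) (v : V) :
    (G.choices T v).Nonempty := by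
  rw [choices, Set.Finite.toFinset_nonempty]
  split_ifs with h
  · exact h
  · exact G.exists_edge v

lemma coe_choices_subset (G : NonStochasticGame V) (T : Set V) (v : V) :
    (G.choices T v : Set V) ⊆ G.out v := by
  rw [choices, Set.Finite.coe_toFinset]
  split_ifs
  · exact Set.inter_subset_left
  · exact subset_rfl

lemma coe_choices {v : V} (h : (G.out v ∩ T).Nonempty) :
    (G.choices T v : Set V) = G.out v ∩ T := by
  rw [choices, Set.Finite.coe_toFinset, if_pos h]

/-- The memoryless strategy of Player 2 that stays in `T` uniformly at random. -/
noncomputable def uniformStrategy (G : NonStochasticGame V) (T : Set V) :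
    Strategy G Player.two where
  move _ h := PMF.uniformOfFinset _ (G.choices_nonempty T h.lastVertex)
  legal _ h _ := by
    rw [PMF.support_uniformOfFinset]
    exact G.coe_choices_subset T _

lemma isMemoryless_uniformStrategy : (G.uniformStrategy T).IsMemoryless := by
  intro n m h h' _ he
  simp only [uniformStrategy, he]

lemma playsUniformlyIn_uniformStrategy (hT : G.IsTrapForOne T) :
    (G.uniformStrategy T).PlaysUniformlyIn T := by
  intro n h ho hv
  have hc := coe_choices ((hT _ hv).2 ho)
  rw [← hc]
  refine ⟨fun u hu => ?_, fun u hu =>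
    PMF.uniformOfFinset_apply_of_notMem (G.choices_nonempty T _) hu⟩
  rw [Set.ncard_coe_finset]
  exact PMF.uniformOfFinset_apply_of_mem (G.choices_nonempty T _) hu

lemma Strategy.PlaysUniformlyIn.mixesIn {τ : Strategy G Player.two}
    (hτ : τ.PlaysUniformlyIn T) : τ.MixesIn T (Nat.card V : ℝ)⁻¹ := by
  intro n h ho hv
  obtain ⟨h1, h2⟩ := hτ n h ho hv
  refine ⟨fun u hu => ?_, fun u hu => ?_⟩
  · rw [h1 u hu, ENNReal.toReal_inv, ENNReal.toReal_natCast]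
    have hpos : 0 < (G.out h.lastVertex ∩ T).ncard := (Set.ncard_pos (Set.toFinite _)).2 ⟨u, hu⟩
    have hle : (G.out h.lastVertex ∩ T).ncard ≤ Nat.card V := Set.ncard_le_card _
    gcongr
  · by_contra hn
    exact hu (h2 u fun hm => hn hm.2)

end UniformStrategy

/-- Repeated attempts restart at varying vertices, so they need one bound for all of them: the
maximum over the finite vertex set. -/
lemma exists_forall_canForce {V : Type*} [Finite V] (G : NonStochasticGame V) (ℓ : ℕ) :
    ∃ N, ∀ v ∈ G.winningRegion Player.two (G.coFWMP ℓ),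
      G.CanForce ℓ (G.winningRegion Player.two (G.coFWMP ℓ)) N 0 (fun _ => v) := by
  have := Fintype.ofFinite V
  have hex : ∀ v, ∃ k, v ∈ G.winningRegion Player.two (G.coFWMP ℓ) →
      G.CanForce ℓ (G.winningRegion Player.two (G.coFWMP ℓ)) k 0 (fun _ => v) := fun v => by
    by_cases hv : v ∈ G.winningRegion Player.two (G.coFWMP ℓ)
    · obtain ⟨k, hk⟩ := exists_canForce hv
      exact ⟨k, fun _ => hk⟩
    · exact ⟨0, fun h => absurd h hv⟩
  choose K hK using hex
  exact ⟨Finset.univ.sup K, fun v hv => (hK v hv).mono (Finset.le_sup (Finset.mem_univ v))⟩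

end NonStochasticGame

theorem mainTheorem11 {V : Type*} [Finite V] [MeasurableSpace V] [DiscreteMeasurableSpace V]
    (G : NonStochasticGame V) (ℓ : ℕ) (hℓ : 1 ≤ ℓ) :
    G.IsTrapForOne (G.winningRegion Player.two (G.coFWMP ℓ)) ∧
    ∃ τ : NonStochasticGame.Strategy G Player.two,
      τ.IsMemoryless ∧
      τ.PlaysUniformlyIn (G.winningRegion Player.two (G.coFWMP ℓ)) ∧
      ∀ v ∈ G.winningRegion Player.two (G.coFWMP ℓ),
        G.AlmostSurelyWinning τ (G.coFWMP ℓ) v := by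
  have hT := NonStochasticGame.isTrapForOne_winningRegion (G := G) (ℓ := ℓ)
  have hU := NonStochasticGame.playsUniformlyIn_uniformStrategy hT
  obtain ⟨N, hN⟩ := G.exists_forall_canForce ℓ
  refine ⟨hT, _, NonStochasticGame.isMemoryless_uniformStrategy, hU, fun v hv => ?_⟩
  have hcard : 1 ≤ Nat.card V := Nat.card_pos_iff.2 ⟨⟨v⟩, inferInstance⟩
  have hcard' : (1 : ℝ) ≤ Nat.card V := by exact_mod_cast hcard
  exact NonStochasticGame.almostSurelyWinning_of_canForce hT hU.mixesIn
    (inv_pos.2 (by linarith)) (inv_le_one_of_one_le₀ hcard') hN hv
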